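/- Let $K$ be an uncountable algebraically closed field and $n\in\mathbb N$. Let $S=K[x_{ij}:\ i\in\mathbb N,\ j\in\{1,\dots,n\}]$, let $\mathbb A^n_{K,\infty}=\operatorname{Spec}(S)$, and let $\operatorname{Sym}(\infty)=\bigcup_k\operatorname{Sym}(k)$ act on $S$ by $\sigma(x_{ij})=x_{\sigma(i)j}$ and accordingly on $\mathbb A^n_{K,\infty}$. The set $\mathbb A^n_{K,\infty}(K)$ of $K$-rational points is identified with the set of sequences $(p_i)_{i\in\mathbb N}$ in $\mathbb A^n_K(K)=K^n$. For every $K$-scheme $Y$, the set $Y(K)$ carries the Zariski topology, i.e. the pullback of the topology of $Y$ along the natural map $Y(K)\to Y$. Theorem. Let $X$ be an irreducible projective scheme over $K$ and let $\Sigma$ be a closed subscheme of $X\times_K\mathbb A^n_K$ such that the projection $\operatorname{pr}_1:\Sigma\to X$ is flat; let $\operatorname{pr}_2:\Sigma\to\mathbb A^n_K$ be the other projection. Assume that there is a nonempty open subset $U\subset X(K)$ such that for all $x\in U$ the fiber $\operatorname{pr}_1^{-1}(x)$ is irreducible. Then the set $$\operatorname{Seq}(\Sigma)=\{(p_i)_{i\in\mathbb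 N}\subset\mathbb A^n_K(K):\ \exists x\in X(K)\ \forall i\in\mathbb N:\ p_i\in\operatorname{pr}_2(\operatorname{pr}_1^{-1}(x))\}$$ of sequences lying entirely in the set of $K$-rational points of a single fiber of $\operatorname{pr}_1$ is an irreducible subset of $\mathbb A^n_{K,\infty}(K)$. In particular, the generic point $\operatorname{sq}(\Sigma)$ of the closure of $\operatorname{Seq}(\Sigma)$ in $\mathbb A^n_{K,\infty}$ is defined, and it is a fixed point of $\mathbb A^n_{K,\infty}$ under the action of $\operatorname{Sym}(\infty)$. -/

import Mathlib

open CategoryTheory CategoryTheory.Limits AlgebraicGeometry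

universe u

noncomputable section

namespace SeqFamilies

/-! ### Schemes over a field, rational points, affine and projective space -/

section Schemes

variable (K : Type u) [Field K]

/-- `𝔸ⁿ_K = Spec K[x₁, …, xₙ]`. -/
abbrev affineSpace (n : ℕ) : Scheme.{u} :=
  Spec (.of (MvPolynomial (Fin n) K))

/-- The structure morphism `𝔸ⁿ_K ⟶ Spec K`. -/
def affineSpaceStr (n : ℕ) : affineSpace K n ⟶ Spec (.of K) :=
  Spec.map (CommRingCat.ofHom (MvPolynomial.C (σ := Fin n) (R := K)))

variable {K} in
/-- The `K`-rational point of `𝔸ⁿ_K` with coordinates `a ∈ Kⁿ`. -/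
def affinePoint {n : ℕ} (a : Fin n → K) : Spec (.of K) ⟶ affineSpace K n :=
  Spec.map (CommRingCat.ofHom (MvPolynomial.eval a))

attribute [local instance] MvPolynomial.gradedAlgebra in
/-- `ℙᵐ_K = Proj K[x₀, …, xₘ]`. -/
abbrev projSpace (m : ℕ) : Scheme.{u} :=
  Proj (MvPolynomial.homogeneousSubmodule (Fin (m + 1)) K)

attribute [local instance] MvPolynomial.gradedAlgebra in
/-- The structure morphism `ℙᵐ_K ⟶ Spec K`. -/
def projSpaceStr (m : ℕ) : projSpace K m ⟶ Spec (.of K) :=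
  Proj.toSpecZero (MvPolynomial.homogeneousSubmodule (Fin (m + 1)) K) ≫
    Spec.map (CommRingCat.ofHom
      (algebraMap K (MvPolynomial.homogeneousSubmodule (Fin (m + 1)) K 0)))

variable {K}

/-- A `K`-scheme is projective if it is isomorphic, over `K`, to a closed subscheme of some
projective space `ℙᵐ_K`. -/
def IsProjectiveOver {X : Scheme.{u}} (f : X ⟶ Spec (.of K)) : Prop :=
  ∃ (m : ℕ) (i : X ⟶ projSpace K m), IsClosedImmersion i ∧ i ≫ projSpaceStr K m = f

/-- The set `X(K)` of `K`-rational points of the `K`-scheme `f : X ⟶ Spec K`. -/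
structure RatPoint {X : Scheme.{u}} (f : X ⟶ Spec (.of K)) : Type u where
  /-- the morphism `Spec K ⟶ X` -/
  hom : Spec (.of K) ⟶ X
  /-- it is a morphism of `K`-schemes -/
  hom_comp : hom ≫ f = 𝟙 _

/-- The point of the topological space `X` underlying a `K`-rational point. -/
def RatPoint.pt {X : Scheme.{u}} {f : X ⟶ Spec (.of K)} (x : RatPoint f) : X :=
  x.hom (IsLocalRing.closedPoint K)

/-- The Zariski topology on `X(K)`: the pullback of the topology of `X`. -/
instance {X : Scheme.{u}} (f : X ⟶ Spec (.of K)) : TopologicalSpace (RatPoint f) :=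
  TopologicalSpace.induced RatPoint.pt inferInstance

end Schemes

/-! ### The space `𝔸ⁿ_{K,∞}` with the action of `Sym(∞)` -/

section Infinite

variable (K : Type u) [Field K] (n : ℕ)

/-- The ring `S = K[x_{ij} : i ∈ ℕ, j ∈ [n]]`. -/
abbrev SeqRing : Type u := MvPolynomial (ℕ × Fin n) K

/-- The (underlying space of the) affine scheme `𝔸ⁿ_{K,∞} = Spec S`. -/
abbrev InfSpace : Type u := PrimeSpectrum (SeqRing K n)

/-- The set `𝔸ⁿ_{K,∞}(K)`, identified with the set of sequences in `𝔸ⁿ_K(K) = Kⁿ`. -/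
structure InfPoint : Type u where
  /-- the sequence of points of `Kⁿ` -/
  seq : ℕ → Fin n → K

variable {K n}

/-- The natural map `𝔸ⁿ_{K,∞}(K) → 𝔸ⁿ_{K,∞}`: a sequence `p` is sent to the kernel of the
homomorphism `S → K`, `x_{ij} ↦ (pᵢ)ⱼ`. -/
def InfPoint.toSpace (p : InfPoint K n) : InfSpace K n :=
  ⟨RingHom.ker (MvPolynomial.eval fun ij : ℕ × Fin n => p.seq ij.1 ij.2), RingHom.ker_isPrime _⟩

/-- The Zariski topology on `𝔸ⁿ_{K,∞}(K)`: the pullback of the topology of `𝔸ⁿ_{K,∞}`. -/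
instance : TopologicalSpace (InfPoint K n) :=
  TopologicalSpace.induced InfPoint.toSpace inferInstance

theorem InfPoint.continuous_toSpace : Continuous (InfPoint.toSpace (K := K) (n := n)) :=
  continuous_induced_dom

/-- `Sym(∞) = ⋃ₖ Sym(k)`: the permutations of `ℕ` that fix all but finitely many elements. -/
def SymInf : Subgroup (Equiv.Perm ℕ) where
  carrier := {σ | ∃ k : ℕ, ∀ i, k ≤ i → σ i = i}
  one_mem' := ⟨0, fun _ _ => rfl⟩
  mul_mem' := by
    rintro σ τ ⟨k, hk⟩ ⟨l, hl⟩
    refine ⟨max k l, fun i hi => ?_⟩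
    rw [Equiv.Perm.mul_apply, hl i (le_trans (le_max_right k l) hi),
      hk i (le_trans (le_max_left k l) hi)]
  inv_mem' := by
    rintro σ ⟨k, hk⟩
    exact ⟨k, fun i hi => by rw [Equiv.Perm.inv_eq_iff_eq, hk i hi]⟩

/-- The action of `σ` on `S`: `σ(x_{ij}) = x_{σ(i)j}`. -/
def permRing (σ : Equiv.Perm ℕ) : SeqRing K n →+* SeqRing K n :=
  (MvPolynomial.rename fun ij : ℕ × Fin n => (σ ij.1, ij.2)).toRingHom

theorem permRing_one (f : SeqRing K n) : permRing 1 f = f :=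
  MvPolynomial.rename_id_apply f

theorem permRing_mul (σ τ : Equiv.Perm ℕ) (f : SeqRing K n) :
    permRing (σ * τ) f = permRing σ (permRing τ f) := by
  have h := MvPolynomial.rename_rename (fun ij : ℕ × Fin n => (τ ij.1, ij.2))
    (fun ij : ℕ × Fin n => (σ ij.1, ij.2)) f
  exact h.symm

/-- The induced action of `Sym(∞)` on `𝔸ⁿ_{K,∞}`: a prime ideal `𝔭` is sent to
`σ(𝔭) = {f : σ⁻¹(f) ∈ 𝔭}`. -/
instance : MulAction SymInf (InfSpace K n) where
  smul σ x := PrimeSpectrum.comap (permRing (σ⁻¹ : Equiv.Perm ℕ)) x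
  one_smul x := by
    ext f
    change permRing ((1 : Equiv.Perm ℕ)⁻¹) f ∈ x.asIdeal ↔ _
    rw [inv_one, permRing_one]
  mul_smul σ τ x := by
    ext f
    change permRing ((σ * τ : Equiv.Perm ℕ)⁻¹) f ∈ x.asIdeal ↔
      permRing (τ⁻¹ : Equiv.Perm ℕ) (permRing (σ⁻¹ : Equiv.Perm ℕ) f) ∈ x.asIdeal
    rw [mul_inv_rev, permRing_mul]

end Infinite

/-! ### Families of closed subschemes of `𝔸ⁿ_K` and their sequences -/

section Families

variable {K : Type u} [Field K] {n : ℕ} {X Sig : Scheme.{u}} {f : X ⟶ Spec (.of K)}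

/-- `pr₁ : Σ ⟶ X` for `ι : Σ ⟶ X ×_K 𝔸ⁿ_K`. -/
def pr₁ (ι : Sig ⟶ pullback f (affineSpaceStr K n)) : Sig ⟶ X :=
  ι ≫ pullback.fst f (affineSpaceStr K n)

/-- `pr₂ : Σ ⟶ 𝔸ⁿ_K` for `ι : Σ ⟶ X ×_K 𝔸ⁿ_K`. -/
def pr₂ (ι : Sig ⟶ pullback f (affineSpaceStr K n)) : Sig ⟶ affineSpace K n :=
  ι ≫ pullback.snd f (affineSpaceStr K n)

/-- The set `pr₂(pr₁⁻¹(x)) ⊆ 𝔸ⁿ_K(K) = Kⁿ` of `K`-rational points of the fiber over `x ∈ X(K)`. -/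
def fiberPoints (ι : Sig ⟶ pullback f (affineSpaceStr K n)) (x : RatPoint f) :
    Set (Fin n → K) :=
  {a | ∃ s : Spec (.of K) ⟶ Sig, s ≫ pr₁ ι = x.hom ∧ s ≫ pr₂ ι = affinePoint a}

/-- `Seq(Σ)`: the sequences in `𝔸ⁿ_K(K)` that are entirely contained in a single fiber. -/
def SeqSet (ι : Sig ⟶ pullback f (affineSpaceStr K n)) : Set (InfPoint K n) :=
  {p | ∃ x : RatPoint f, ∀ i : ℕ, p.seq i ∈ fiberPoints ι x}

/-- `sq(Σ)`: if `Seq(Σ)` is irreducible, the generic point of the closure of (the image of)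
`Seq(Σ)` in `𝔸ⁿ_{K,∞}`. -/
def sq (ι : Sig ⟶ pullback f (affineSpaceStr K n)) (h : IsIrreducible (SeqSet ι)) : InfSpace K n :=
  (h.image InfPoint.toSpace InfPoint.continuous_toSpace.continuousOn).genericPoint

/-- The defining property of `sq(Σ)`. -/
theorem isGenericPoint_sq (ι : Sig ⟶ pullback f (affineSpaceStr K n))
    (h : IsIrreducible (SeqSet ι)) :
    IsGenericPoint (sq ι h) (closure (InfPoint.toSpace '' SeqSet ι)) :=
  IsIrreducible.isGenericPoint_genericPoint_closure _

end Families

end SeqFamilies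

end

/-! Irreducibility of `Seq(Σ)` means that two polynomials `F` and `G`, each nonzero at some sequence
in `Seq(Σ)`, are both nonzero at a common one. Say `F` is nonzero at a sequence in the fiber over
`x`, and `G` at one in the fiber over `y`; neither fiber need be irreducible.

Only finitely many terms of a sequence enter `F`, so `F` lives on a finite fibre power of `Σ` over
`X`. That power is flat and locally of finite presentation over `X`, hence maps openly to `X`; the
image of the locus `F ≠ 0` is an open neighbourhood of `x` over whose rational points `F` still has
a nonvanishing sequence (`exists_isOpen_forall_exists_evalSeq_ne_zero`). The same holds for `G` and
`y`. As `X` is irreducible, these neighbourhoods and the given open set meet, and by the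
Nullstellensatz they share a rational point `z`. The fiber over `z` is irreducible, so its sequences
form an irreducible set (`PolyPreirreducible.exists_evalSeq_ne_zero`), which yields one sequence
that serves both `F` and `G`.

The generic point is fixed because permuting a sequence keeps it in the same fiber. -/

noncomputable section

namespace SeqFamilies

/-! ### Zariski topology on sequences, and the action of `Sym(∞)` -/

section Topological

variable {K : Type u} [Field K] {n : ℕ}

/-- A set `V ⊆ Kⁿ` is preirreducible for the Zariski topology: two polynomials that do not vanish
identically on `V` are both nonzero at some point of `V`. -/
def PolyPreirreducible (V : Set (Fin n → K)) : Prop :=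
  ∀ g h : MvPolynomial (Fin n) K, (∃ a ∈ V, MvPolynomial.eval a g ≠ 0) →
    (∃ a ∈ V, MvPolynomial.eval a h ≠ 0) →
    ∃ a ∈ V, MvPolynomial.eval a g ≠ 0 ∧ MvPolynomial.eval a h ≠ 0

/-- Evaluation of a polynomial in the coordinates of a sequence of points of `Kⁿ`. -/
def evalSeq (p : ℕ → Fin n → K) : SeqRing K n →+* K :=
  MvPolynomial.eval fun ij : ℕ × Fin n => p ij.1 ij.2

theorem exists_evalSeq_congr (F : SeqRing K n) :
    ∃ k : ℕ, ∀ p q : ℕ → Fin n → K, (∀ i < k, p i = q i) → evalSeq p F = evalSeq q F := by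
  classical
  -- One more than the largest term index occurring in `F`, or 0 if `F` is constant.
  refine ⟨F.vars.sup (fun ij => ij.1 + 1), fun p q h => ?_⟩
  refine MvPolynomial.eval₂Hom_congr' rfl (fun ij hij _ => ?_) rfl
  have := Finset.le_sup (f := fun ij : ℕ × Fin n => ij.1 + 1) hij
  rw [h ij.1 this]

theorem exists_eval_eq_evalSeq_update (p : ℕ → Fin n → K) (k : ℕ) (F : SeqRing K n) :
    ∃ g : MvPolynomial (Fin n) K, ∀ a, MvPolynomial.eval a g = evalSeq (Function.update p k a) F := by
  refine ⟨MvPolynomial.bind₁ (fun ij : ℕ × Fin n =>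
    if ij.1 = k then MvPolynomial.X ij.2 else MvPolynomial.C (p ij.1 ij.2)) F, fun a => ?_⟩
  rw [← MvPolynomial.coe_aeval_eq_eval, RingHom.coe_coe, MvPolynomial.aeval_bind₁, evalSeq,
    ← MvPolynomial.coe_aeval_eq_eval, RingHom.coe_coe]
  congr 2
  funext ij
  by_cases h : ij.1 = k
  · simp [h]
  · simp [h]

/-- The two sequences are made equal one term at a time. With all other terms frozen, `F` and `G`
become polynomials in the `k`-th term alone, and preirreducibility of `V` provides a common value
for that term at which both are nonzero. -/
theorem PolyPreirreducible.exists_agree {V : Set (Fin n → K)} (hV : PolyPreirreducible V)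
    {F G : SeqRing K n} {p q : ℕ → Fin n → K} (hp : ∀ i, p i ∈ V) (hq : ∀ i, q i ∈ V)
    (hF : evalSeq p F ≠ 0) (hG : evalSeq q G ≠ 0) (k : ℕ) :
    ∃ p' q' : ℕ → Fin n → K, (∀ i, p' i ∈ V) ∧ (∀ i, q' i ∈ V) ∧ evalSeq p' F ≠ 0 ∧
      evalSeq q' G ≠ 0 ∧ ∀ i < k, p' i = q' i := by
  induction k with
  | zero => exact ⟨p, q, hp, hq, hF, hG, fun i hi => absurd hi (Nat.not_lt_zero i)⟩
  | succ k ih =>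
    obtain ⟨p', q', hp', hq', hF', hG', h⟩ := ih
    obtain ⟨g, hg⟩ := exists_eval_eq_evalSeq_update p' k F
    obtain ⟨g', hg'⟩ := exists_eval_eq_evalSeq_update q' k G
    obtain ⟨a, haV, ha, ha'⟩ := hV g g' ⟨p' k, hp' k, by rwa [hg, Function.update_eq_self]⟩
      ⟨q' k, hq' k, by rwa [hg', Function.update_eq_self]⟩
    refine ⟨Function.update p' k a, Function.update q' k a, ?_, ?_, by rwa [← hg], by rwa [← hg'],
      fun i hi => ?_⟩
    · intro i; by_cases hi : i = k
      · simpa [hi] using haV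
      · simpa [hi] using hp' i
    · intro i; by_cases hi : i = k
      · simpa [hi] using haV
      · simpa [hi] using hq' i
    · by_cases hik : i = k
      · simp [hik]
      · simpa [hik] using h i (by omega)

/-- The set of sequences in an irreducible subset of `Kⁿ` is irreducible. -/
theorem PolyPreirreducible.exists_evalSeq_ne_zero {V : Set (Fin n → K)} (hV : PolyPreirreducible V)
    {F G : SeqRing K n} {p q : ℕ → Fin n → K} (hp : ∀ i, p i ∈ V) (hq : ∀ i, q i ∈ V)
    (hF : evalSeq p F ≠ 0) (hG : evalSeq q G ≠ 0) :
    ∃ r : ℕ → Fin n → K, (∀ i, r i ∈ V) ∧ evalSeq r F ≠ 0 ∧ evalSeq r G ≠ 0 := by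
  obtain ⟨k, hk⟩ := exists_evalSeq_congr G
  -- Agreement on the terms occurring in `G` suffices: `p'` then serves for both polynomials.
  obtain ⟨p', q', hp', -, hF', hG', h⟩ := hV.exists_agree hp hq hF hG k
  exact ⟨p', hp', hF', by rwa [hk p' q' h]⟩

/-- The basic opens `D(F)` form a basis of `Spec S`, and a sequence lies in `D(F)` exactly when `F`
does not vanish at it. -/
theorem isIrreducible_of_evalSeq {A : Set (InfPoint K n)} (hne : A.Nonempty)
    (h : ∀ F G : SeqRing K n, (∃ p ∈ A, evalSeq p.seq F ≠ 0) → (∃ p ∈ A, evalSeq p.seq G ≠ 0) →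
      ∃ p ∈ A, evalSeq p.seq F ≠ 0 ∧ evalSeq p.seq G ≠ 0) : IsIrreducible A := by
  refine ⟨hne, ?_⟩
  have key : ∀ (u : Set (InfPoint K n)), IsOpen u → ∀ p ∈ u, ∃ F : SeqRing K n,
      evalSeq p.seq F ≠ 0 ∧ ∀ q : InfPoint K n, evalSeq q.seq F ≠ 0 → q ∈ u := by
    rintro _ ⟨v, hv, rfl⟩ p hp
    obtain ⟨_, ⟨F, rfl⟩, hpF, hF⟩ :=
      PrimeSpectrum.isTopologicalBasis_basic_opens.exists_subset_of_mem_open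
        (show InfPoint.toSpace p ∈ v from hp) hv
    exact ⟨F, hpF, fun q hq => hF hq⟩
  rintro u v hu hv ⟨p, hpA, hpu⟩ ⟨q, hqA, hqv⟩
  obtain ⟨F, hF, hFu⟩ := key u hu p hpu
  obtain ⟨G, hG, hGv⟩ := key v hv q hqv
  obtain ⟨r, hrA, hrF, hrG⟩ := h F G ⟨p, hpA, hF⟩ ⟨q, hqA, hG⟩
  exact ⟨r, hrA, hFu r hrF, hGv r hrG⟩

theorem symInf_smul_toSpace (σ : SymInf) (p : InfPoint K n) :
    σ • p.toSpace = InfPoint.toSpace ⟨fun i => p.seq ((σ⁻¹ : SymInf).1 i)⟩ := by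
  ext F
  change evalSeq p.seq (permRing (σ⁻¹ : Equiv.Perm ℕ) F) = 0 ↔
    evalSeq (fun i => p.seq ((σ⁻¹ : SymInf).1 i)) F = 0
  have : evalSeq p.seq (permRing (σ⁻¹ : Equiv.Perm ℕ) F) =
      evalSeq (fun i => p.seq ((σ⁻¹ : SymInf).1 i)) F :=
    MvPolynomial.eval_rename _ _ _
  rw [this]

theorem continuous_symInf_smul (σ : SymInf) : Continuous fun z : InfSpace K n => σ • z :=
  PrimeSpectrum.continuous_comap _

variable {X Sig : Scheme.{u}} {f : X ⟶ Spec (.of K)}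

/-- Reindexing a sequence does not change the fiber containing it; the reverse inclusion comes from
`σ⁻¹`. -/
theorem symInf_smul_image_seqSet (ι : Sig ⟶ pullback f (affineSpaceStr K n)) (σ : SymInf) :
    (fun z => σ • z) '' (InfPoint.toSpace '' SeqSet ι) = InfPoint.toSpace '' SeqSet ι := by
  have key : ∀ τ : SymInf,
      (fun z => τ • z) '' (InfPoint.toSpace '' SeqSet ι) ⊆ InfPoint.toSpace '' SeqSet ι := by
    rintro τ _ ⟨_, ⟨p, ⟨x, hx⟩, rfl⟩, rfl⟩
    exact ⟨⟨fun i => p.seq ((τ⁻¹ : SymInf).1 i)⟩, ⟨x, fun i => hx _⟩,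
      (symInf_smul_toSpace τ p).symm⟩
  refine (key σ).antisymm fun z hz => ⟨σ⁻¹ • z, key σ⁻¹ ⟨z, hz, rfl⟩, smul_inv_smul σ z⟩

/-- A continuous map sends a generic point of a closed set to a generic point of the closure of its
image. Here that closure is the original set, and generic points in the spectrum are unique. -/
theorem sq_mem_fixedPoints (ι : Sig ⟶ pullback f (affineSpaceStr K n))
    (h : IsIrreducible (SeqSet ι)) :
    sq ι h ∈ MulAction.fixedPoints SymInf (InfSpace K n) := by
  intro σ
  have h₁ := (isGenericPoint_sq ι h).image (continuous_symInf_smul σ)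
  rw [closure_image_closure (continuous_symInf_smul σ), symInf_smul_image_seqSet] at h₁
  exact h₁.eq (isGenericPoint_sq ι h)

end Topological

/-! ### Finiteness conditions -/

section Finiteness

variable {K : Type u} [Field K] {n : ℕ}

instance locallyOfFiniteType_affineSpaceStr : LocallyOfFiniteType (affineSpaceStr K n) := by
  rw [affineSpaceStr, HasRingHomProperty.Spec_iff (P := @LocallyOfFiniteType)]
  exact (RingHom.finiteType_algebraMap (A := K) (B := MvPolynomial (Fin n) K)).mpr inferInstance

attribute [local instance] MvPolynomial.gradedAlgebra in
theorem algebraMap_homogeneousSubmodule_zero_surjective (m : ℕ) :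
    Function.Surjective
      (algebraMap K (MvPolynomial.homogeneousSubmodule (Fin (m + 1)) K 0)) := by
  rintro ⟨p, hp⟩
  rw [MvPolynomial.mem_homogeneousSubmodule, ← MvPolynomial.totalDegree_zero_iff_isHomogeneous,
    MvPolynomial.totalDegree_eq_zero_iff_eq_C] at hp
  exact ⟨_, Subtype.ext hp.symm⟩

attribute [local instance] MvPolynomial.gradedAlgebra in
instance locallyOfFiniteType_projSpaceStr (m : ℕ) : LocallyOfFiniteType (projSpaceStr K m) := by
  have : Algebra.FiniteType (MvPolynomial.homogeneousSubmodule (Fin (m + 1)) K 0)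
      (MvPolynomial (Fin (m + 1)) K) := by
    have : IsScalarTower K (MvPolynomial.homogeneousSubmodule (Fin (m + 1)) K 0)
      (MvPolynomial (Fin (m + 1)) K) := 
      ⟨fun a b c => smul_mul_assoc a (b : MvPolynomial (Fin (m + 1)) K) c⟩
    exact Algebra.FiniteType.of_restrictScalars_finiteType K _ _
  have : LocallyOfFiniteType (Spec.map (CommRingCat.ofHom
      (algebraMap K (MvPolynomial.homogeneousSubmodule (Fin (m + 1)) K 0)))) := by
    rw [HasRingHomProperty.Spec_iff (P := @LocallyOfFiniteType)]
    exact RingHom.FiniteType.of_surjective _ (algebraMap_homogeneousSubmodule_zero_surjective m)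
  rw [projSpaceStr]
  infer_instance

theorem IsProjectiveOver.locallyOfFiniteType {X : Scheme.{u}} {f : X ⟶ Spec (.of K)}
    (h : IsProjectiveOver f) : LocallyOfFiniteType f := by
  obtain ⟨m, i, hi, rfl⟩ := h
  infer_instance

/-- Affine opens of `X` have Noetherian coordinate rings, over which finite type and finite
presentation agree. Finite presentation is what makes flat morphisms open. -/
theorem locallyOfFinitePresentation_of_locallyOfFiniteType {X Y : Scheme.{u}}
    (f : X ⟶ Spec (.of K)) [LocallyOfFiniteType f] (g : Y ⟶ X) [LocallyOfFiniteType g] :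
    LocallyOfFinitePresentation g := by
  rw [HasRingHomProperty.iff_appLE (P := @LocallyOfFinitePresentation)]
  intro U V e
  have hN : IsNoetherianRing Γ(Spec (.of K), ⊤) :=
    isNoetherianRing_of_ringEquiv K (Scheme.ΓSpecIso (.of K)).symm.commRingCatIsoToRingEquiv
  have hU := HasRingHomProperty.appLE @LocallyOfFiniteType f inferInstance
    ⟨⊤, isAffineOpen_top _⟩ U le_top
  have : IsNoetherianRing Γ(X, U) := by
    algebraize [(f.appLE ⊤ U le_top).hom]
    exact Algebra.FiniteType.isNoetherianRing Γ(Spec (.of K), ⊤) Γ(X, U)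
  exact RingHom.FinitePresentation.of_finiteType.mp
    (HasRingHomProperty.appLE @LocallyOfFiniteType g inferInstance U V e)

end Finiteness

/-! ### Rational points: evaluation and existence -/

section RationalPoints

variable {K : Type u} [Field K] {n : ℕ}

/-- The value at a `K`-rational point of a global function. -/
def evalAt {Z : Scheme.{u}} (z : Spec (.of K) ⟶ Z) : Γ(Z, ⊤) →+* K :=
  (z.appTop ≫ (Scheme.ΓSpecIso (.of K)).hom).hom

theorem evalAt_comp {Z W : Scheme.{u}} (z : Spec (.of K) ⟶ Z) (g : Z ⟶ W) (s : Γ(W, ⊤)) :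
    evalAt (z ≫ g) s = evalAt z (g.appTop.hom s) := by
  rw [evalAt, Scheme.Hom.comp_appTop, Category.assoc]
  rfl

theorem evalAt_specMap {R : CommRingCat.{u}} (φ : R ⟶ .of K) (r : R) :
    evalAt (Spec.map φ) ((Scheme.ΓSpecIso R).inv.hom r) = φ.hom r := by
  have h : (Scheme.ΓSpecIso R).inv ≫ (Spec.map φ).appTop ≫ (Scheme.ΓSpecIso (.of K)).hom = φ := by
    rw [Scheme.ΓSpecIso_naturality, Iso.inv_hom_id_assoc]
  exact congr($(h).hom r)

/-- The maximal ideal of `K` is zero. This is the bridge between values in `K` and open subsets of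
the scheme. -/
theorem evalAt_ne_zero_iff {Z : Scheme.{u}} (z : Spec (.of K) ⟶ Z) (s : Γ(Z, ⊤)) :
    evalAt z s ≠ 0 ↔ z (IsLocalRing.closedPoint K) ∈ Z.basicOpen s := by
  have h : z (IsLocalRing.closedPoint K) ∈ Z.basicOpen s ↔
      (IsLocalRing.closedPoint K : Spec (.of K)) ∈ z ⁻¹ᵁ Z.basicOpen s := Iff.rfl
  rw [h, Scheme.preimage_basicOpen_top, basicOpen_eq_of_affine']
  change _ ↔ evalAt z s ∉ (IsLocalRing.closedPoint K).asIdeal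
  have h₀ : (IsLocalRing.closedPoint K).asIdeal = ⊥ := IsLocalRing.maximalIdeal_eq_bot
  rw [h₀, Ideal.mem_bot]

/-- The constant functions on a scheme over `K`. -/
def constants {Z : Scheme.{u}} (h : Z ⟶ Spec (.of K)) : K →+* Γ(Z, ⊤) :=
  ((Scheme.ΓSpecIso (.of K)).inv ≫ h.appTop).hom

theorem evalAt_constants {Z : Scheme.{u}} {h : Z ⟶ Spec (.of K)} {z : Spec (.of K) ⟶ Z}
    (hz : z ≫ h = 𝟙 _) (c : K) : evalAt z (constants h c) = c := by
  have : evalAt z (constants h c) = evalAt (z ≫ h) ((Scheme.ΓSpecIso (.of K)).inv.hom c) := by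
    rw [evalAt_comp]; rfl
  rw [this, hz, ← Spec.map_id, evalAt_specMap]
  rfl

/-- The pullback of a polynomial along a morphism to `𝔸ⁿ_K`. -/
def pullbackPoly {Z : Scheme.{u}} (q : Z ⟶ affineSpace K n) : MvPolynomial (Fin n) K →+* Γ(Z, ⊤) :=
  ((Scheme.ΓSpecIso (.of (MvPolynomial (Fin n) K))).inv ≫ q.appTop).hom

theorem evalAt_pullbackPoly {Z : Scheme.{u}} {q : Z ⟶ affineSpace K n} {z : Spec (.of K) ⟶ Z}
    {a : Fin n → K} (hz : z ≫ q = affinePoint a) (g : MvPolynomial (Fin n) K) :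
    evalAt z (pullbackPoly q g) = MvPolynomial.eval a g := by
  have : evalAt z (pullbackPoly q g) =
      evalAt (z ≫ q) ((Scheme.ΓSpecIso (.of (MvPolynomial (Fin n) K))).inv.hom g) := by
    rw [evalAt_comp]; rfl
  rw [this, hz, affinePoint, evalAt_specMap]
  rfl

theorem exists_eq_affinePoint {s : Spec (.of K) ⟶ affineSpace K n}
    (hs : s ≫ affineSpaceStr K n = 𝟙 _) : ∃ a : Fin n → K, s = affinePoint a := by
  obtain ⟨φ, rfl⟩ := Spec.map_surjective s
  rw [affineSpaceStr, ← Spec.map_comp, ← Spec.map_id, Spec.map_injective.eq_iff] at hs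
  refine ⟨fun j => φ.hom (MvPolynomial.X j), ?_⟩
  rw [affinePoint]
  congr 1
  ext1
  refine MvPolynomial.ringHom_ext (fun c => ?_) fun j => ?_
  · have := congr($(hs).hom c)
    simpa using this
  · simp

theorem affinePoint_injective : Function.Injective (affinePoint : (Fin n → K) → _) := by
  intro a b h
  funext j
  have := Spec.map_injective h
  simpa using congr($(this).hom (MvPolynomial.X j))

/-- The pullback of a polynomial along a sequence of morphisms to `𝔸ⁿ_K`. -/
def pullbackSeqPoly {Z : Scheme.{u}} (h : Z ⟶ Spec (.of K)) (q : ℕ → (Z ⟶ affineSpace K n)) :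
    SeqRing K n →+* Γ(Z, ⊤) :=
  MvPolynomial.eval₂Hom (constants h) fun ij => pullbackPoly (q ij.1) (MvPolynomial.X ij.2)

theorem evalAt_pullbackSeqPoly {Z : Scheme.{u}} {h : Z ⟶ Spec (.of K)}
    {q : ℕ → (Z ⟶ affineSpace K n)} {z : Spec (.of K) ⟶ Z} (hz : z ≫ h = 𝟙 _)
    {p : ℕ → Fin n → K} (hp : ∀ i, z ≫ q i = affinePoint (p i)) (F : SeqRing K n) :
    evalAt z (pullbackSeqPoly h q F) = evalSeq p F := by
  have : (evalAt z).comp (pullbackSeqPoly h q) = evalSeq p := by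
    refine MvPolynomial.ringHom_ext (fun c => ?_) fun ij => ?_
    · simp [pullbackSeqPoly, evalSeq, evalAt_constants hz]
    · simp [pullbackSeqPoly, evalSeq, evalAt_pullbackPoly (hp ij.1)]
  exact congr($this F)

theorem apply_closedPoint_of_comp_eq {X P : Scheme.{u}} {f : X ⟶ Spec (.of K)} {π : P ⟶ X}
    {x : RatPoint f} {z : Spec (.of K) ⟶ P} (hz : z ≫ π = x.hom) :
    π (z (IsLocalRing.closedPoint K)) = x.pt :=
  (Scheme.Hom.comp_apply z π _).symm.trans congr($hz (IsLocalRing.closedPoint K))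

variable [IsAlgClosed K]

/-- Nullstellensatz: `Z` is Jacobson, so a nonempty locally closed subset contains a closed point of
`Z`, and closed points are rational since `K` is algebraically closed. -/
theorem exists_ratPoint_of_isLocallyClosed {Z : Scheme.{u}} (h : Z ⟶ Spec (.of K))
    [LocallyOfFiniteType h] {A : Set Z} (hA : IsLocallyClosed A) (hne : A.Nonempty) :
    ∃ z : RatPoint h, z.pt ∈ A := by
  have : JacobsonSpace Z := LocallyOfFiniteType.jacobsonSpace h
  obtain ⟨y, hyA, hy⟩ := nonempty_inter_closedPoints hne hA
  refine ⟨⟨pointOfClosedPoint h y hy, pointOfClosedPoint_comp h y hy⟩, ?_⟩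
  have : RatPoint.pt ⟨pointOfClosedPoint h y hy, pointOfClosedPoint_comp h y hy⟩ = y :=
    pointOfClosedPoint_apply h y hy _
  rwa [this]

theorem RatPoint.isClosed_pt {X : Scheme.{u}} {f : X ⟶ Spec (.of K)} [LocallyOfFiniteType f]
    (x : RatPoint f) : IsClosed {x.pt} :=
  (pointEquivClosedPoint f ⟨x.hom, x.hom_comp⟩).2

/-- Rational points of `X` are closed, so the part of the fiber inside `D` is locally closed in `P`
and has a rational point. Its image and `x` agree as morphisms because a rational point is
determined by its underlying point. -/
theorem exists_section_over {X P : Scheme.{u}} {f : X ⟶ Spec (.of K)} [LocallyOfFiniteType f]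
    (π : P ⟶ X) [LocallyOfFiniteType π] (x : RatPoint f) {D : Set P} (hD : IsOpen D)
    (hne : (π ⁻¹' {x.pt} ∩ D).Nonempty) :
    ∃ z : Spec (.of K) ⟶ P, z ≫ π = x.hom ∧ z (IsLocalRing.closedPoint K) ∈ D := by
  obtain ⟨z, hz, hzD⟩ := exists_ratPoint_of_isLocallyClosed (π ≫ f)
    ((x.isClosed_pt.preimage π.continuous).isLocallyClosed.inter hD.isLocallyClosed) hne
  refine ⟨z.hom, ext_of_apply_closedPoint_eq f ?_ x.hom_comp ?_, hzD⟩
  · rw [Category.assoc, z.hom_comp]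
  · exact (Scheme.Hom.comp_apply z.hom π _).trans hz

end RationalPoints

/-! ### Fibre powers and irreducibility of `Seq(Σ)` -/

section Family

variable {K : Type u} [Field K] {n : ℕ} {X Sig : Scheme.{u}} {f : X ⟶ Spec (.of K)}

theorem pr₁_comp (ι : Sig ⟶ pullback f (affineSpaceStr K n)) :
    pr₁ ι ≫ f = pr₂ ι ≫ affineSpaceStr K n := by
  simp [pr₁, pr₂, pullback.condition]

instance locallyOfFiniteType_pr₁ (ι : Sig ⟶ pullback f (affineSpaceStr K n))
    [IsClosedImmersion ι] : LocallyOfFiniteType (pr₁ ι) := by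
  rw [pr₁]; infer_instance

theorem exists_mem_fiberPoints (ι : Sig ⟶ pullback f (affineSpaceStr K n)) (x : RatPoint f)
    {s : Spec (.of K) ⟶ Sig} (hs : s ≫ pr₁ ι = x.hom) :
    ∃ a ∈ fiberPoints ι x, s ≫ pr₂ ι = affinePoint a := by
  obtain ⟨a, ha⟩ := exists_eq_affinePoint (s := s ≫ pr₂ ι)
    (by rw [Category.assoc, ← pr₁_comp, reassoc_of% hs, x.hom_comp])
  exact ⟨a, ⟨s, hs, ha⟩, ha⟩

theorem isIrreducible_preimage_of_fiber {Y Z : Scheme.{u}} (g : Y ⟶ Z) (z : Z)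
    [IrreducibleSpace (g.fiber z)] : IsIrreducible (g ⁻¹' {z}) := by
  rw [← g.range_fiberι, ← Set.image_univ]
  exact (IrreducibleSpace.isIrreducible_univ _).image _ (g.fiberι z).continuous.continuousOn

/-- Fibre powers: given a flat family `g : Y ⟶ X`, there is a flat family over `X` parametrizing
the sequences of points in a fiber, of which only the terms up to `k` matter. -/
theorem exists_fiberPower {Y : Scheme.{u}} (g : Y ⟶ X) [Flat g] [LocallyOfFinitePresentation g]
    (k : ℕ) :
    ∃ (P : Scheme.{u}) (π : P ⟶ X) (_ : Flat π) (_ : LocallyOfFinitePresentation π)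
      (s : ℕ → (P ⟶ Y)), (∀ i, s i ≫ g = π) ∧
      ∀ (T : Scheme.{u}) (x : T ⟶ X) (t : ℕ → (T ⟶ Y)), (∀ i, t i ≫ g = x) →
        ∃ z : T ⟶ P, z ≫ π = x ∧ ∀ i < k, z ≫ s i = t i := by
  induction k with
  -- Starting from `Y` instead of `X` gives one spare factor, which supplies a default value in the
  -- fiber for the terms of index `≥ k`.
  | zero => exact ⟨Y, g, ‹_›, ‹_›, fun _ => 𝟙 Y, fun _ => Category.id_comp g,
      fun T x t ht => ⟨t 0, ht 0, fun i hi => absurd hi (Nat.not_lt_zero i)⟩⟩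
  | succ k ih =>
    obtain ⟨P, π, _, _, s, hs, H⟩ := ih
    refine ⟨pullback π g, pullback.fst π g ≫ π, inferInstance, inferInstance,
      fun i => if i = k then pullback.snd π g else pullback.fst π g ≫ s i, fun i => ?_,
      fun T x t ht => ?_⟩
    · dsimp only
      split_ifs
      · exact pullback.condition.symm
      · rw [Category.assoc, hs]
    · obtain ⟨z, hz, hzs⟩ := H T x t ht
      refine ⟨pullback.lift z (t k) (by rw [hz, ht]),
        by rw [pullback.lift_fst_assoc, hz], fun i hi => ?_⟩
      dsimp only
      split_ifs with hik
      · rw [pullback.lift_snd, hik]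
      · rw [pullback.lift_fst_assoc]
        exact hzs i (by omega)

variable [IsAlgClosed K] [LocallyOfFiniteType f]

/-- The nonvanishing loci of the two polynomials are open in `Σ` and both meet the irreducible
fiber, so they meet inside it, and the Nullstellensatz gives a rational point there. -/
theorem polyPreirreducible_fiberPoints (ι : Sig ⟶ pullback f (affineSpaceStr K n))
    [IsClosedImmersion ι] (x : RatPoint f) (hx : IrreducibleSpace ((pr₁ ι).fiber x.pt)) :
    PolyPreirreducible (fiberPoints ι x) := by
  rintro g h ⟨a, ⟨s, hs, ha⟩, hag⟩ ⟨b, ⟨t, ht, hb⟩, hbh⟩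
  rw [← evalAt_pullbackPoly ha, evalAt_ne_zero_iff] at hag
  rw [← evalAt_pullbackPoly hb, evalAt_ne_zero_iff] at hbh
  obtain ⟨z, hz, hzg, hzh⟩ := exists_section_over (pr₁ ι) x
    ((Sig.basicOpen _).isOpen.inter (Sig.basicOpen _).isOpen)
    ((isIrreducible_preimage_of_fiber (pr₁ ι) x.pt).2 _ _ (Sig.basicOpen _).isOpen
      (Sig.basicOpen _).isOpen ⟨_, apply_closedPoint_of_comp_eq hs, hag⟩
      ⟨_, apply_closedPoint_of_comp_eq ht, hbh⟩)
  obtain ⟨c, hc, hzc⟩ := exists_mem_fiberPoints ι x hz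
  refine ⟨c, hc, ?_, ?_⟩
  · rw [← evalAt_pullbackPoly hzc, evalAt_ne_zero_iff]; exact hzg
  · rw [← evalAt_pullbackPoly hzc, evalAt_ne_zero_iff]; exact hzh

theorem fiberPoints_nonempty (ι : Sig ⟶ pullback f (affineSpaceStr K n))
    [IsClosedImmersion ι] (x : RatPoint f) (hx : IrreducibleSpace ((pr₁ ι).fiber x.pt)) :
    (fiberPoints ι x).Nonempty := by
  obtain ⟨z, hz, -⟩ := exists_section_over (pr₁ ι) x isOpen_univ
    (by simpa using (isIrreducible_preimage_of_fiber (pr₁ ι) x.pt).1)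
  obtain ⟨a, ha, -⟩ := exists_mem_fiberPoints ι x hz
  exact ⟨a, ha⟩

/-- The points `x` such that a given polynomial does not vanish identically on the sequences in the
fiber over `x` form a neighbourhood of each of its rational points. -/
theorem exists_isOpen_forall_exists_evalSeq_ne_zero
    (ι : Sig ⟶ pullback f (affineSpaceStr K n)) [IsClosedImmersion ι] [Flat (pr₁ ι)]
    (F : SeqRing K n) (x : RatPoint f) {p : ℕ → Fin n → K} (hp : ∀ i, p i ∈ fiberPoints ι x)
    (hF : evalSeq p F ≠ 0) :
    ∃ W : Set X, IsOpen W ∧ x.pt ∈ W ∧ ∀ y : RatPoint f, y.pt ∈ W →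
      ∃ q : ℕ → Fin n → K, (∀ i, q i ∈ fiberPoints ι y) ∧ evalSeq q F ≠ 0 := by
  have := locallyOfFinitePresentation_of_locallyOfFiniteType f (pr₁ ι)
  obtain ⟨k, hk⟩ := exists_evalSeq_congr F
  obtain ⟨P, π, _, _, s, hs, H⟩ := exists_fiberPower (pr₁ ι) k
  have points : ∀ (y : RatPoint f) (z : Spec (.of K) ⟶ P), z ≫ π = y.hom →
      ∃ q : ℕ → Fin n → K, (∀ i, q i ∈ fiberPoints ι y) ∧
        (∀ i, z ≫ s i ≫ pr₂ ι = affinePoint (q i)) ∧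
        evalAt z (pullbackSeqPoly (π ≫ f) (fun i => s i ≫ pr₂ ι) F) = evalSeq q F := by
    intro y z hz
    choose q hq hzq using fun i => exists_mem_fiberPoints ι y (s := z ≫ s i)
      (by rw [Category.assoc, hs, hz])
    simp only [Category.assoc] at hzq
    exact ⟨q, hq, hzq, evalAt_pullbackSeqPoly (by rw [reassoc_of% hz, y.hom_comp]) hzq F⟩
  set e := pullbackSeqPoly (π ≫ f) (fun i => s i ≫ pr₂ ι) F
  -- The neighbourhood is the image of the locus `F ≠ 0` in the fibre power, open because `π` is
  -- flat and locally of finite presentation.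
  refine ⟨π '' P.basicOpen e, π.isOpenMap _ (P.basicOpen e).isOpen, ?_, fun y hy => ?_⟩
  · choose t ht htp using hp
    obtain ⟨z, hz, hzs⟩ := H _ x.hom t ht
    obtain ⟨q, -, hzq, hq⟩ := points x z hz
    refine ⟨z (IsLocalRing.closedPoint K), ?_, apply_closedPoint_of_comp_eq hz⟩
    -- The sequence `q` read off from `z` is only known to match `p` in its first `k` terms, which
    -- is all that `F` sees.
    rw [SetLike.mem_coe, ← evalAt_ne_zero_iff, hq, ← hk p q fun i hi => ?_]
    · exact hF
    · have h₁ : affinePoint (p i) = affinePoint (q i) := by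
        rw [← htp, ← hzq, reassoc_of% hzs i hi]
      exact affinePoint_injective h₁
  · obtain ⟨w, hw, hwy⟩ := hy
    obtain ⟨z, hz, hzD⟩ := exists_section_over π y (P.basicOpen e).isOpen ⟨w, hwy, hw⟩
    obtain ⟨q, hq, -, hqe⟩ := points y z hz
    exact ⟨q, hq, by rwa [← hqe, evalAt_ne_zero_iff]⟩

theorem isIrreducible_seqSet [IrreducibleSpace X] (ι : Sig ⟶ pullback f (affineSpaceStr K n))
    [IsClosedImmersion ι] [Flat (pr₁ ι)] (U : Set (RatPoint f)) (hUo : IsOpen U) (hUne : U.Nonempty)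
    (hU : ∀ x ∈ U, IrreducibleSpace ((pr₁ ι).fiber x.pt)) : IsIrreducible (SeqSet ι) := by
  obtain ⟨U', hU'o, rfl⟩ := hUo
  obtain ⟨x₀, hx₀⟩ := hUne
  refine isIrreducible_of_evalSeq ?_ ?_
  · obtain ⟨a, ha⟩ := fiberPoints_nonempty ι x₀ (hU x₀ hx₀)
    exact ⟨⟨fun _ => a⟩, x₀, fun _ => ha⟩
  · rintro F G ⟨p, ⟨x, hp⟩, hF⟩ ⟨q, ⟨y, hq⟩, hG⟩
    obtain ⟨W, hW, hxW, HW⟩ := exists_isOpen_forall_exists_evalSeq_ne_zero ι F x hp hF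
    obtain ⟨W', hW', hyW', HW'⟩ := exists_isOpen_forall_exists_evalSeq_ne_zero ι G y hq hG
    -- The points `x` and `y` may lie outside the locus of irreducible fibers; irreducibility of `X`
    -- allows both to be replaced by a single point inside it.
    have hne := nonempty_preirreducible_inter (hW.inter hW') hU'o
      (nonempty_preirreducible_inter hW hW' ⟨_, hxW⟩ ⟨_, hyW'⟩) ⟨_, hx₀⟩
    obtain ⟨z, ⟨hzW, hzW'⟩, hzU⟩ := exists_ratPoint_of_isLocallyClosed f
      ((hW.inter hW').inter hU'o).isLocallyClosed hne
    obtain ⟨p', hp', hF'⟩ := HW z hzW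
    obtain ⟨q', hq', hG'⟩ := HW' z hzW'
    obtain ⟨r, hr, hrFG⟩ :=
      (polyPreirreducible_fiberPoints ι z (hU z hzU)).exists_evalSeq_ne_zero hp' hq' hF' hG'
    exact ⟨⟨r⟩, ⟨z, hr⟩, hrFG⟩

end Family

end SeqFamilies

end

theorem mainTheorem5 {K : Type u} [Field K] [IsAlgClosed K] [Uncountable K] (n : ℕ)
    {X : Scheme.{u}} (f : X ⟶ Spec (.of K)) (hX : SeqFamilies.IsProjectiveOver f)
    [IrreducibleSpace X]
    {Sig : Scheme.{u}} (ι : Sig ⟶ pullback f (SeqFamilies.affineSpaceStr K n))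
    [IsClosedImmersion ι]
    (hflat : Flat (SeqFamilies.pr₁ ι))
    (U : Set (SeqFamilies.RatPoint f)) (hUo : IsOpen U) (hUne : U.Nonempty)
    (hU : ∀ x ∈ U, IrreducibleSpace ((SeqFamilies.pr₁ ι).fiber x.pt)) :
    ∃ h : IsIrreducible (SeqFamilies.SeqSet ι),
      SeqFamilies.sq ι h ∈
        MulAction.fixedPoints SeqFamilies.SymInf (SeqFamilies.InfSpace K n) := by
  have := hX.locallyOfFiniteType
  exact ⟨SeqFamilies.isIrreducible_seqSet ι U hUo hUne hU, SeqFamilies.sq_mem_fixedPoints ι _⟩
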